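/- Let $B$ be a finite-dimensional (unital) $C^*$-algebra, let $\psi$ be a faithful state on $B$, and let $C$ be an arbitrary, not necessarily unital, $C^*$-algebra. Let $\operatorname{Tr}$ be the non-normalised trace on $B\cong\bigoplus_k \mathbb M_{n_k}$, that is, the sum of the usual matrix traces of the blocks, and let $Q\in B$ be the unique positive invertible element with $\psi(a)=\operatorname{Tr}(Qa)$ for all $a\in B$. For $z\in\mathbb C$ set $\sigma_z(a)=Q^{iz}aQ^{-iz}$ for $a\in B$, so that $\sigma_{-i/2}(a)=Q^{1/2}aQ^{-1/2}$. For $a\in B$ and $c\in C$ let $\psi a\in B^*$ be the functional $b\mapsto\psi(ab)$, and let $\theta_{\psi a,c}:B\to C$ be the map $b\mapsto\psi(ab)c$; these maps span the space $\mathcal B(B,C)$ of all linear maps $B\to C$. Let $B^{\operatorname{op}}$ be the opposite $C^*$-algebra of $B$ (same vector space and involution, reversed product). Then there is a unique linear map \[ \Psi':\mathcal B(B,C)\to C\otimes B^{\operatorname{op}},\qquad \theta_{\psi a,c}\mapsto c\otimes\sigma_{-i/2}(a)\qquad(a\in B,\ c\in C), \] and $\Psi'$ restricts to a bijection from the set of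 completely positive maps $B\to C$ onto the set of positive elements of the $C^*$-algebra $C\otimes B^{\operatorname{op}}$. -/

import Mathlib

open scoped TensorProduct ComplexOrder

noncomputable section

/-- A faithful state on a unital C⋆-algebra `B`: a positive, normalised linear functional which
vanishes on `b⋆ b` only if `b = 0`. -/
structure FaithfulState (B : Type*) [CStarAlgebra B] extends B →ₗ[ℂ] ℂ where
  nonneg' : ∀ b : B, 0 ≤ toFun (star b * b)
  map_one' : toFun 1 = 1
  faithful' : ∀ b : B, toFun (star b * b) = 0 → b = 0

section Trace

/-- A finite-dimensional C⋆-algebra is semisimple: its Jacobson radical is nilpotent, and a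
nilpotent self-adjoint element vanishes. -/
theorem isSemisimpleRing_of_finiteDimensional_cstar (B : Type*) [CStarAlgebra B]
    [FiniteDimensional ℂ B] : IsSemisimpleRing B := by
  have : IsArtinianRing B := IsArtinianRing.of_finite ℂ B
  rw [IsArtinianRing.isSemisimpleRing_iff_jacobson, eq_bot_iff]
  intro x hx
  have hy : star x * x ∈ Ring.jacobson B := Ideal.mul_mem_left _ _ hx
  have hnil : IsNilpotent (Ring.jacobson B) := IsSemiprimaryRing.isNilpotent
  obtain ⟨n, hn⟩ := hnil
  have hpow : (star x * x) ^ (2 ^ n) = 0 := by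
    have h1 : (star x * x) ^ n ∈ Ring.jacobson B ^ n := Ideal.pow_mem_pow hy n
    rw [hn] at h1
    have h2 : (star x * x) ^ n = 0 := by simpa using h1
    obtain ⟨k, hk⟩ := Nat.exists_eq_add_of_le (Nat.lt_two_pow_self (n := n)).le
    rw [hk, pow_add, h2, zero_mul]
  have h3 := (IsSelfAdjoint.star_mul_self x).norm_pow_two_pow n
  rw [hpow, norm_zero] at h3
  have h4 : star x * x = 0 := by
    by_contra h
    exact (pow_ne_zero _ (norm_ne_zero_iff.mpr h)) h3.symm
  simpa using CStarRing.star_mul_self_eq_zero_iff x |>.mp h4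

variable (B : Type*) [CStarAlgebra B] [FiniteDimensional ℂ B]

theorem exists_matrixDecomposition :
    ∃ (n : ℕ) (d : Fin n → ℕ), (∀ i, NeZero (d i)) ∧
      Nonempty (B ≃ₐ[ℂ] Π i, Matrix (Fin (d i)) (Fin (d i)) ℂ) := by
  have := isSemisimpleRing_of_finiteDimensional_cstar B
  exact IsSemisimpleRing.exists_algEquiv_pi_matrix_of_isAlgClosed ℂ B

/-- The sum of the matrix traces on a direct sum of matrix algebras. -/
def blockTrace {n : ℕ} (d : Fin n → ℕ) :
    (Π i, Matrix (Fin (d i)) (Fin (d i)) ℂ) →ₗ[ℂ] ℂ :=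
  ∑ i, Matrix.traceLinearMap (Fin (d i)) ℂ ℂ ∘ₗ LinearMap.proj i

/-- The non-normalised trace `Tr` of a finite-dimensional C⋆-algebra `B ≅ ⨁ M_{d i}(ℂ)`: the sum
of the usual matrix traces of the blocks. By `matrixTrace_eq` below it is independent of the
decomposition that is used to compute it. -/
def matrixTrace : B →ₗ[ℂ] ℂ :=
  blockTrace (exists_matrixDecomposition B).choose_spec.choose ∘ₗ
    ((exists_matrixDecomposition B).choose_spec.choose_spec.2.some).toLinearMap

theorem blockTrace_apply {n : ℕ} (d : Fin n → ℕ) (x : Π i, Matrix (Fin (d i)) (Fin (d i)) ℂ) :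
    blockTrace d x = ∑ i, (x i).trace := by
  simp [blockTrace]

theorem blockTrace_mul_comm {n : ℕ} (d : Fin n → ℕ)
    (x y : Π i, Matrix (Fin (d i)) (Fin (d i)) ℂ) :
    blockTrace d (x * y) = blockTrace d (y * x) := by
  simp only [blockTrace_apply, Pi.mul_apply]
  exact Finset.sum_congr rfl fun i _ => Matrix.trace_mul_comm _ _

theorem blockTrace_single_mul {n : ℕ} (d : Fin n → ℕ)
    (x : Π i, Matrix (Fin (d i)) (Fin (d i)) ℂ) (k : Fin n) (i j : Fin (d k)) :
    blockTrace d (Pi.single k (Matrix.single i j 1) * x) = x k j i := by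
  rw [blockTrace_apply, Finset.sum_eq_single k]
  · simp [Matrix.trace_single_mul]
  · intro b _ hb
    simp [Pi.single_eq_of_ne hb]
  · simp

/-- A minimal idempotent (`f x f ∈ ℂ f` for all `x`) of a direct sum of matrix algebras has
trace one. -/
theorem blockTrace_of_minimal {n : ℕ} (d : Fin n → ℕ)
    (f : Π i, Matrix (Fin (d i)) (Fin (d i)) ℂ) (hf : f * f = f) (hf0 : f ≠ 0)
    (hmin : ∀ x, ∃ c : ℂ, f * x * f = c • f) : blockTrace d f = 1 := by
  obtain ⟨k, j, i, hji⟩ : ∃ k j i, f k j i ≠ 0 := by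
    by_contra! h
    exact hf0 (by ext k j i; exact h k j i)
  obtain ⟨c, hc⟩ := hmin (Pi.single k (Matrix.single i j 1))
  have hent : f k j i * f k j i = c * f k j i := by
    have := congrFun (congrFun (congrFun hc k) j) i
    simpa [Matrix.mul_assoc, Matrix.mul_apply, Matrix.single_apply, ite_and] using this
  have hcf : c = f k j i := (mul_right_cancel₀ hji hent).symm
  have htr := congrArg (blockTrace d) hc
  rw [mul_assoc, blockTrace_mul_comm, mul_assoc, hf, blockTrace_single_mul, map_smul,
    smul_eq_mul, hcf] at htr
  exact (mul_left_cancel₀ hji (by rw [mul_one]; exact htr)).symm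

theorem blockTrace_algEquiv {n m : ℕ} (d : Fin n → ℕ) (d' : Fin m → ℕ)
    (e : (Π i, Matrix (Fin (d i)) (Fin (d i)) ℂ) ≃ₐ[ℂ] Π i, Matrix (Fin (d' i)) (Fin (d' i)) ℂ)
    (x : Π i, Matrix (Fin (d i)) (Fin (d i)) ℂ) : blockTrace d' (e x) = blockTrace d x := by
  suffices h : blockTrace d' ∘ₗ e.toLinearMap = blockTrace d from LinearMap.congr_fun h x
  refine LinearMap.pi_ext' fun k => ?_
  refine Matrix.ext_linearMap ℂ fun i j => LinearMap.ext_ring ?_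
  simp only [LinearMap.comp_apply, LinearMap.single_apply, AlgEquiv.toLinearMap_apply,
    Matrix.singleLinearMap_apply]
  have hmul : ∀ p q r s : Fin (d k),
      (Pi.single k (Matrix.single p q (1 : ℂ)) : Π i, Matrix (Fin (d i)) (Fin (d i)) ℂ) *
        Pi.single k (Matrix.single r s 1) =
      if q = r then Pi.single k (Matrix.single p s 1) else 0 := by
    intro p q r s
    rw [← Pi.single_mul]
    split_ifs with h
    · subst h; simp
    · rw [Matrix.single_mul_single_of_ne _ _ _ _ h]; simp
  have hR : blockTrace d (Pi.single k (Matrix.single i j 1)) = if i = j then 1 else 0 := by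
    have := blockTrace_single_mul d 1 k i j
    rw [mul_one] at this
    rw [this, Pi.one_apply, Matrix.one_apply]
    simp [eq_comm]
  rw [hR]
  split_ifs with hij
  · subst hij
    apply blockTrace_of_minimal
    · rw [← map_mul, hmul, if_pos rfl]
    · intro h0
      have h1 := (map_eq_zero_iff e e.injective).mp h0
      have h2 := congrFun (congrFun (congrFun h1 k) i) i
      simp at h2
    · intro y
      refine ⟨(e.symm y) k i i, ?_⟩
      apply e.symm.injective
      simp only [map_mul, map_smul, AlgEquiv.symm_apply_apply]
      funext l
      by_cases hl : l = k
      · subst hl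
        ext a b
        simp only [Pi.mul_apply, Pi.single_eq_same,
          Pi.smul_apply, Matrix.smul_apply, Matrix.single_mul_mul_single, one_mul, mul_one,
          Matrix.single_apply, smul_eq_mul]
        split_ifs <;> simp
      · simp [Pi.single_eq_of_ne hl]
  · have h1 : (Pi.single k (Matrix.single i j (1 : ℂ)) : Π i, Matrix (Fin (d i)) (Fin (d i)) ℂ) =
        Pi.single k (Matrix.single i i 1) * Pi.single k (Matrix.single i j 1) := by
      rw [hmul, if_pos rfl]
    rw [h1, map_mul, blockTrace_mul_comm, ← map_mul, hmul, if_neg (Ne.symm hij), map_zero,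
      map_zero]

variable {B}

/-- `matrixTrace` is computed by any decomposition of `B` into matrix blocks. -/
theorem matrixTrace_eq {m : ℕ} (d : Fin m → ℕ)
    (e : B ≃ₐ[ℂ] Π i, Matrix (Fin (d i)) (Fin (d i)) ℂ) (b : B) :
    matrixTrace B b = ∑ i, (e b i).trace := by
  have h := blockTrace_algEquiv _ d
    (((exists_matrixDecomposition B).choose_spec.choose_spec.2.some).symm.trans e)
    ((exists_matrixDecomposition B).choose_spec.choose_spec.2.some b)
  rw [← blockTrace_apply]
  simpa [matrixTrace] using h.symm

theorem matrixTrace_mul_comm (x y : B) : matrixTrace B (x * y) = matrixTrace B (y * x) := by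
  simp only [matrixTrace, LinearMap.comp_apply, AlgEquiv.toLinearMap_apply, map_mul]
  exact blockTrace_mul_comm _ _ _

theorem matrixTrace_nondegenerate (x : B) (h : ∀ y, matrixTrace B (x * y) = 0) : x = 0 := by
  obtain ⟨n, d, _, ⟨e⟩⟩ := exists_matrixDecomposition B
  apply e.injective
  rw [map_zero]
  ext k i j
  have h1 := h (e.symm (Pi.single k (Matrix.single j i 1)))
  rw [matrixTrace_eq d e, ← blockTrace_apply, map_mul, AlgEquiv.apply_symm_apply,
    blockTrace_mul_comm, blockTrace_single_mul] at h1
  simpa using h1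

end Trace

section Modular

theorem map_star_of_nonneg {B : Type*} [CStarAlgebra B] [PartialOrder B] [StarOrderedRing B]
    (φ : B →ₗ[ℂ] ℂ) (hφ : ∀ b, 0 ≤ φ (star b * b)) (x : B) : φ (star x) = star (φ x) := by
  have hsa : ∀ y : B, IsSelfAdjoint y → star (φ y) = φ y := by
    intro y hy
    have hpos : ∀ z : B, 0 ≤ z → star (φ z) = φ z := by
      intro z hz
      obtain ⟨w, rfl⟩ := CStarAlgebra.nonneg_iff_eq_star_mul_self.mp hz
      exact (IsSelfAdjoint.of_nonneg (hφ w)).star_eq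
    rw [← CFC.posPart_sub_negPart y hy, map_sub, star_sub, hpos _ (CFC.posPart_nonneg y),
      hpos _ (CFC.negPart_nonneg y)]
  have h1 := hsa _ (realPart x).2
  have h2 := hsa _ (imaginaryPart x).2
  have hx := realPart_add_I_smul_imaginaryPart x
  have hs : star x = (realPart x : B) - Complex.I • (imaginaryPart x : B) := by
    conv_lhs => rw [← hx]
    rw [star_add, star_smul, (realPart x).2.star_eq, (imaginaryPart x).2.star_eq]
    simp [sub_eq_add_neg]
  conv_rhs => rw [← hx]
  rw [hs, map_sub, map_add, star_add, map_smul, smul_eq_mul, star_mul', h1, h2]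
  simp [sub_eq_add_neg]

variable {B : Type*} [CStarAlgebra B] [FiniteDimensional ℂ B] [PartialOrder B] [StarOrderedRing B]

theorem matrixTrace_nonneg (x : B) (hx : 0 ≤ x) : 0 ≤ matrixTrace B x := by
  obtain ⟨n, d, hd, ⟨e⟩⟩ := exists_matrixDecomposition B
  rw [matrixTrace_eq d e]
  refine Finset.sum_nonneg fun i _ => ?_
  have := hd i
  rw [Matrix.trace_eq_sum_roots_charpoly]
  refine Multiset.sum_nonneg fun r hr => ?_
  have h1 : r ∈ spectrum ℂ (e x i) :=
    Matrix.mem_spectrum_of_isRoot_charpoly (Polynomial.isRoot_of_mem_roots hr)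
  have h2 : r ∈ spectrum ℂ x := by
    rw [← AlgEquiv.spectrum_eq e x, Pi.spectrum_eq]
    exact Set.mem_iUnion.mpr ⟨i, h1⟩
  exact spectrum_nonneg_of_nonneg hx h2

/-- A faithful state has a unique positive invertible density with respect to the trace. -/
theorem FaithfulState.existsUnique_density (ψ : FaithfulState B) :
    ∃! Q : B, 0 ≤ Q ∧ IsUnit Q ∧ ∀ a, ψ.toLinearMap a = matrixTrace B (Q * a) := by
  obtain ⟨Q, hQ⟩ : ∃ Q : B, ∀ a, ψ.toLinearMap a = matrixTrace B (Q * a) := by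
    let T : B →ₗ[ℂ] Module.Dual ℂ B := (LinearMap.mul ℂ B).compr₂ (matrixTrace B)
    have hT : Function.Injective T := by
      rw [← LinearMap.ker_eq_bot, LinearMap.ker_eq_bot']
      exact fun x hx => matrixTrace_nondegenerate x fun y => LinearMap.congr_fun hx y
    have hS : Function.Surjective T :=
      (LinearMap.injective_iff_surjective_of_finrank_eq_finrank
        (Subspace.dual_finrank_eq (K := ℂ) (V := B)).symm).mp hT
    obtain ⟨Q, hQ⟩ := hS ψ.toLinearMap
    exact ⟨Q, fun a => (LinearMap.congr_fun hQ a).symm⟩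
  have hsa : IsSelfAdjoint Q := by
    rw [IsSelfAdjoint, ← sub_eq_zero]
    apply matrixTrace_nondegenerate
    intro y
    rw [sub_mul, map_sub, ← hQ, sub_eq_zero]
    have h1 : star Q * y = star (star y * Q) := by simp
    rw [h1, map_star_of_nonneg _ (fun b => matrixTrace_nonneg _ (star_mul_self_nonneg b)),
      matrixTrace_mul_comm, ← hQ, map_star_of_nonneg _ ψ.nonneg', star_star]
  refine ⟨Q, ⟨?_, ?_, hQ⟩, ?_⟩
  · rw [← CFC.negPart_eq_zero_iff Q hsa]
    obtain ⟨w, hw⟩ := CStarAlgebra.nonneg_iff_eq_star_mul_self.mp (CFC.negPart_nonneg Q)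
    have hn : IsSelfAdjoint Q⁻ := IsSelfAdjoint.of_nonneg (CFC.negPart_nonneg Q)
    have h1 : Q * Q⁻ = -(Q⁻ * Q⁻) := by
      conv_lhs => enter [1]; rw [← CFC.posPart_sub_negPart Q hsa]
      rw [sub_mul, CFC.posPart_mul_negPart, zero_sub]
    have h2 : 0 ≤ matrixTrace B (Q⁻ * Q⁻) := by
      have := matrixTrace_nonneg _ (star_mul_self_nonneg Q⁻)
      rwa [hn.star_eq] at this
    have h3 : 0 ≤ ψ.toLinearMap Q⁻ := by rw [hw]; exact ψ.nonneg' w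
    have h4 : ψ.toLinearMap Q⁻ ≤ 0 := by
      rw [hQ, h1, map_neg]; exact neg_nonpos.mpr h2
    have h5 : ψ.toLinearMap (star w * w) = 0 := by rw [← hw]; exact le_antisymm h4 h3
    rw [hw, ψ.faithful' w h5, mul_zero]
  · have hinj : ∀ x, Q * x = 0 → x = 0 := by
      intro x hx
      have h1 : ψ.toLinearMap (star (star x) * star x) = 0 := by
        rw [hQ, star_star, ← mul_assoc, hx, zero_mul, map_zero]
      simpa using ψ.faithful' _ h1
    have hi : Function.Injective (LinearMap.mulLeft ℂ Q) := by
      rw [← LinearMap.ker_eq_bot, LinearMap.ker_eq_bot']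
      exact hinj
    obtain ⟨R, hR⟩ := LinearMap.injective_iff_surjective.mp hi 1
    rw [LinearMap.mulLeft_apply] at hR
    have hR' : R * Q = 1 := by
      rw [← sub_eq_zero]
      apply hinj
      rw [mul_sub, ← mul_assoc, hR, one_mul, mul_one, sub_self]
    exact ⟨⟨Q, R, hR, hR'⟩, rfl⟩
  · rintro Q' ⟨-, -, hQ'⟩
    rw [← sub_eq_zero]
    apply matrixTrace_nondegenerate
    intro y
    rw [sub_mul, map_sub, ← hQ, ← hQ', sub_self]

/-- The density `Q` of a faithful state `ψ`: the unique positive invertible element of `B` with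
`ψ a = Tr (Q a)` for all `a`. -/
def FaithfulState.density (ψ : FaithfulState B) : B := ψ.existsUnique_density.choose

/-- The complex power `Q ^ z` of the density, by functional calculus. -/
def FaithfulState.densityPow (ψ : FaithfulState B) (z : ℂ) : B :=
  cfc (fun t : ℂ => t ^ z) ψ.density

/-- The analytic extension of the modular automorphism group of `ψ`:
`σ_z a = Q ^ (i z) * a * Q ^ (-i z)`. -/
def FaithfulState.modular (ψ : FaithfulState B) (z : ℂ) : B →ₗ[ℂ] B :=
  LinearMap.mulLeftRight ℂ
    (ψ.densityPow (Complex.I * z), ψ.densityPow (-(Complex.I * z)))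

end Modular

section Correspondence

/-- `a ↦ ψ a`, where `ψ a` is the functional `b ↦ ψ (a b)`, is a linear isomorphism of `B` onto
its dual, because `ψ` is faithful. -/
def FaithfulState.dualEquiv {B : Type*} [CStarAlgebra B] [FiniteDimensional ℂ B]
    (ψ : FaithfulState B) : B ≃ₗ[ℂ] Module.Dual ℂ B :=
  LinearEquiv.ofInjectiveOfFinrankEq ((LinearMap.mul ℂ B).compr₂ ψ.toLinearMap)
    (by
      rw [← LinearMap.ker_eq_bot, LinearMap.ker_eq_bot']
      intro a ha
      have h : ψ.toLinearMap (star (star a) * star a) = 0 := by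
        rw [star_star]; exact LinearMap.congr_fun ha (star a)
      simpa using ψ.faithful' _ h)
    Subspace.dual_finrank_eq.symm

/-- The finite-rank map `θ_{f,c} : B → C`, `b ↦ f b • c`. -/
def rankOneMap {B C : Type*} [AddCommMonoid B] [Module ℂ B] [AddCommMonoid C] [Module ℂ C]
    (f : Module.Dual ℂ B) (c : C) : B →ₗ[ℂ] C :=
  f.smulRight c

variable {B : Type*} [CStarAlgebra B] [FiniteDimensional ℂ B] [PartialOrder B]
  [StarOrderedRing B]

/-- The linear map `Ψ' : 𝓑(B, C) → C ⊗ Bᵒᵖ` with `θ_{ψ a, c} ↦ c ⊗ σ_{-i/2} a`. As `B` is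
finite-dimensional, every linear map `B → C` is bounded and is a sum of maps `θ_{ψ a, c}`, and the
algebraic tensor product `C ⊗ Bᵒᵖ` is already the C⋆-algebraic one. -/
def FaithfulState.choiMap (ψ : FaithfulState B) (C : Type*) [NonUnitalCStarAlgebra C] :
    (B →ₗ[ℂ] C) →ₗ[ℂ] C ⊗[ℂ] Bᵐᵒᵖ :=
  TensorProduct.map LinearMap.id
      ((MulOpposite.opLinearEquiv ℂ).toLinearMap ∘ₗ ψ.modular (-(Complex.I / 2)) ∘ₗ
        ψ.dualEquiv.symm.toLinearMap) ∘ₗ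
    (TensorProduct.comm ℂ (Module.Dual ℂ B) C).toLinearMap ∘ₗ
    (dualTensorHomEquiv ℂ B C).symm.toLinearMap

/-- The set of completely positive maps `B → C`, as linear maps. -/
def completelyPositiveMaps (B C : Type*) [CStarAlgebra B] [PartialOrder B] [StarOrderedRing B]
    [NonUnitalCStarAlgebra C] [PartialOrder C] [StarOrderedRing C] : Set (B →ₗ[ℂ] C) :=
  Set.range (CompletelyPositiveMap.toLinearMap : CompletelyPositiveMap B C → B →ₗ[ℂ] C)

/-- The positive elements `x⋆ x` of the C⋆-algebra `C ⊗ Bᵒᵖ`, for the involution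
`(c ⊗ b)⋆ = c⋆ ⊗ b⋆` and the product of `C` and of the opposite algebra of `B`. -/
def positiveElements (B C : Type*) [CStarAlgebra B] [NonUnitalCStarAlgebra C] :
    Set (C ⊗[ℂ] Bᵐᵒᵖ) :=
  {e | ∃ x : C ⊗[ℂ] Bᵐᵒᵖ, e = star x * x}

end Correspondence

end

/-!
Write `h = Q ^ (1/2)` and let `slice x y = (id ⊗ Tr (y ·)) x` for `x ∈ C ⊗ Bᵒᵖ` and `y ∈ B`. As
`ψ (a b) = Tr (Q a b)`, cyclicity of the trace turns the definition of `Ψ'` on the maps `θ_{ψ a, c}`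
into the inversion formula `θ y = slice (Ψ' θ) (h y h)` (`FaithfulState.slice_choiMap`). Since an
element of `C ⊗ Bᵒᵖ` is determined by its slices, `Ψ'` is a linear bijection, and only positivity
has to be compared.

Let `e` be an orthonormal basis of `B` for the inner product `Tr (x⋆ y)`. Parseval's identity gives
`slice (x⋆ x') (u⋆ v) = ∑ l, (slice x (e l⋆ u))⋆ (slice x' (e l⋆ v))` (`slice_star_mul`), on which
both directions rest.

* If `Ψ' θ = x⋆ x`, the identity writes the image under `θ` of a matrix `N⋆ N` over `B` as a sum of
  matrices `N'⋆ N'` over `C`, so `θ` is completely positive.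
* The identity also says that `x ↦ (slice x (e p⋆ e q))_{p q}` is a ⋆-homomorphism into the matrices
  over `C` (`rightRegularRep`), the right regular representation of `Bᵒᵖ` with coefficients in `C`.
  It sends `Ψ' θ` to the image under `θ` of the positive matrix
  `((e p h⁻¹)⋆ (e q h⁻¹))_{p q}`, which is positive if `θ` is completely positive. Its range is
  closed, hence contains the square roots of its positive elements, and it is injective, so `Ψ' θ`
  is of the form `y⋆ y`.
-/

/-! ### Powers of the density and the modular map -/

section Density

variable {B : Type*} [CStarAlgebra B] [FiniteDimensional ℂ B] [PartialOrder B] [StarOrderedRing B]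
  (ψ : FaithfulState B)

theorem FaithfulState.density_nonneg : 0 ≤ ψ.density := ψ.existsUnique_density.choose_spec.1.1

theorem FaithfulState.isUnit_density : IsUnit ψ.density := ψ.existsUnique_density.choose_spec.1.2.1

theorem FaithfulState.apply_eq_trace (a : B) :
    ψ.toLinearMap a = matrixTrace B (ψ.density * a) :=
  ψ.existsUnique_density.choose_spec.1.2.2 a

theorem FaithfulState.pos_of_mem_spectrum_density {t : ℂ} (ht : t ∈ spectrum ℂ ψ.density) :
    0 < t := by
  refine lt_of_le_of_ne (spectrum_nonneg_of_nonneg ψ.density_nonneg ht) ?_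
  rintro rfl
  exact spectrum.zero_notMem ℂ ψ.isUnit_density ht

theorem FaithfulState.continuousOn_cpow_spectrum_density (z : ℂ) :
    ContinuousOn (fun t : ℂ => t ^ z) (spectrum ℂ ψ.density) := fun _ ht =>
  (continuousAt_cpow_const
    (Or.inl (Complex.pos_iff.mp (ψ.pos_of_mem_spectrum_density ht)).1)).continuousWithinAt

theorem FaithfulState.densityPow_add (z w : ℂ) :
    ψ.densityPow (z + w) = ψ.densityPow z * ψ.densityPow w := by
  rw [densityPow, densityPow, densityPow, ← cfc_mul _ _ _
    (ψ.continuousOn_cpow_spectrum_density z) (ψ.continuousOn_cpow_spectrum_density w)]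
  exact cfc_congr fun t ht => Complex.cpow_add _ _ (ψ.pos_of_mem_spectrum_density ht).ne'

theorem FaithfulState.densityPow_zero : ψ.densityPow 0 = 1 := by
  have := ψ.density_nonneg.isSelfAdjoint.isStarNormal
  simp only [densityPow, Complex.cpow_zero]
  exact cfc_const_one ℂ ψ.density

theorem FaithfulState.densityPow_one : ψ.densityPow 1 = ψ.density := by
  have := ψ.density_nonneg.isSelfAdjoint.isStarNormal
  simp only [densityPow, Complex.cpow_one]
  exact cfc_id' ℂ ψ.density

theorem FaithfulState.star_densityPow_ofReal (r : ℝ) :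
    star (ψ.densityPow r) = ψ.densityPow r := by
  rw [densityPow, ← cfc_star]
  refine cfc_congr fun t ht => ?_
  obtain ⟨s, hs, rfl⟩ := RCLike.nonneg_iff_exists_ofReal.mp (ψ.pos_of_mem_spectrum_density ht).le
  simp only [Complex.coe_algebraMap]
  simp only [← Complex.ofReal_cpow hs]
  exact Complex.conj_ofReal _

/-- The square root `Q ^ (1/2)` of the density of `ψ`. -/
noncomputable def FaithfulState.sqrtDensity : B := ψ.densityPow (1 / 2)

/-- The inverse square root `Q ^ (-1/2)` of the density of `ψ`. -/
noncomputable def FaithfulState.invSqrtDensity : B := ψ.densityPow (-(1 / 2))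

theorem FaithfulState.sqrtDensity_mul_self : ψ.sqrtDensity * ψ.sqrtDensity = ψ.density := by
  rw [sqrtDensity, ← densityPow_add, add_halves, densityPow_one]

@[simp]
theorem FaithfulState.sqrtDensity_mul_invSqrtDensity : ψ.sqrtDensity * ψ.invSqrtDensity = 1 := by
  rw [sqrtDensity, invSqrtDensity, ← densityPow_add, add_neg_cancel, densityPow_zero]

@[simp]
theorem FaithfulState.invSqrtDensity_mul_sqrtDensity : ψ.invSqrtDensity * ψ.sqrtDensity = 1 := by
  rw [sqrtDensity, invSqrtDensity, ← densityPow_add, neg_add_cancel, densityPow_zero]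

@[simp]
theorem FaithfulState.star_sqrtDensity : star ψ.sqrtDensity = ψ.sqrtDensity := by
  simpa [sqrtDensity] using ψ.star_densityPow_ofReal (1 / 2)

@[simp]
theorem FaithfulState.star_invSqrtDensity : star ψ.invSqrtDensity = ψ.invSqrtDensity := by
  simpa [invSqrtDensity] using ψ.star_densityPow_ofReal (-(1 / 2))

theorem FaithfulState.modular_neg_I_div_two (a : B) :
    ψ.modular (-(Complex.I / 2)) a = ψ.sqrtDensity * a * ψ.invSqrtDensity := by
  have h : Complex.I * -(Complex.I / 2) = 1 / 2 := by
    linear_combination (-1 / 2 : ℂ) * Complex.I_mul_I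
  rw [modular, h, LinearMap.mulLeftRight_apply]
  rfl

end Density

/-! ### The trace inner product -/

section Trace

variable {B : Type*} [CStarAlgebra B] [FiniteDimensional ℂ B] [PartialOrder B] [StarOrderedRing B]

theorem matrixTrace_star (x : B) : matrixTrace B (star x) = star (matrixTrace B x) :=
  map_star_of_nonneg _ (fun b => matrixTrace_nonneg _ (star_mul_self_nonneg b)) x

/-- The trace is faithful, because `Tr (x⋆ x) = ψ (y⋆ y)` for `y = x Q ^ (-1/2)`. -/
theorem eq_zero_of_matrixTrace_star_mul_self (ψ : FaithfulState B) (x : B)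
    (h : matrixTrace B (star x * x) = 0) : x = 0 := by
  have h1 : x * ψ.invSqrtDensity = 0 := by
    apply ψ.faithful'
    change ψ.toLinearMap _ = 0
    have h2 : ψ.sqrtDensity * ψ.sqrtDensity * (ψ.invSqrtDensity * star x * (x * ψ.invSqrtDensity)) =
        ψ.sqrtDensity * (ψ.sqrtDensity * ψ.invSqrtDensity) * (star x * x * ψ.invSqrtDensity) := by
      simp only [mul_assoc]
    rw [ψ.apply_eq_trace, ← ψ.sqrtDensity_mul_self, star_mul, ψ.star_invSqrtDensity, h2,
      ψ.sqrtDensity_mul_invSqrtDensity, mul_one, matrixTrace_mul_comm, mul_assoc,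
      ψ.invSqrtDensity_mul_sqrtDensity, mul_one, h]
  simpa [mul_assoc] using congrArg (· * ψ.sqrtDensity) h1

/-- The reconstruction formula of an orthonormal basis, for an inner product given by its core. -/
theorem InnerProductSpace.Core.exists_sum_inner_smul_eq {V : Type*} [AddCommGroup V] [Module ℂ V]
    [FiniteDimensional ℂ V] (core : InnerProductSpace.Core ℂ V) :
    ∃ (n : ℕ) (e : Fin n → V), ∀ b, ∑ i, core.inner (e i) b • e i = b := by
  let : NormedAddCommGroup V := core.toNormedAddCommGroup
  let : InnerProductSpace ℂ V := InnerProductSpace.ofCore core.toCore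
  exact ⟨_, stdOrthonormalBasis ℂ V, fun b => (stdOrthonormalBasis ℂ V).sum_repr' b⟩

/-- `B` has an orthonormal basis for the inner product `⟨x, y⟩ = Tr (x⋆ y)`; only its
reconstruction formula is recorded. -/
theorem exists_trace_frame (ψ : FaithfulState B) :
    ∃ (n : ℕ) (e : Fin n → B), ∀ b, ∑ i, matrixTrace B (star (e i) * b) • e i = b := by
  let core : InnerProductSpace.Core ℂ B :=
    { inner := fun x y => matrixTrace B (star x * y)
      conj_inner_symm := fun x y => by
        change star _ = _
        rw [← matrixTrace_star, star_mul, star_star]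
      re_inner_nonneg := fun x =>
        (Complex.nonneg_iff.mp (matrixTrace_nonneg _ (star_mul_self_nonneg x))).1
      add_left := fun x y z => by simp [add_mul]
      smul_left := fun x y r => by simp
      definite := fun x hx => eq_zero_of_matrixTrace_star_mul_self ψ x hx }
  exact core.exists_sum_inner_smul_eq

/-- Parseval's identity for the inner product `Tr (u⋆ v)`. -/
theorem matrixTrace_star_mul_eq_sum {n : ℕ} {e : Fin n → B}
    (he : ∀ b, ∑ i, matrixTrace B (star (e i) * b) • e i = b) (u v : B) :
    matrixTrace B (star u * v) =
      ∑ l, star (matrixTrace B (star (e l) * u)) * matrixTrace B (star (e l) * v) := by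
  conv_lhs => rw [← he v]
  simp only [Finset.mul_sum, map_sum, mul_smul_comm, map_smul, smul_eq_mul]
  refine Finset.sum_congr rfl fun l _ => ?_
  rw [← matrixTrace_star, star_mul, star_star, mul_comm]

end Trace

/-! ### Slice maps -/

section Slice

variable {B C : Type*} [CStarAlgebra B] [FiniteDimensional ℂ B] [NonUnitalCStarAlgebra C]

/-- The slice maps of `C ⊗ Bᵒᵖ` along the functionals `Tr (y ·)`: `(c ⊗ b, y) ↦ Tr (y b) • c`. -/
noncomputable def slice (B C : Type*) [CStarAlgebra B] [FiniteDimensional ℂ B]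
    [NonUnitalCStarAlgebra C] : C ⊗[ℂ] Bᵐᵒᵖ →ₗ[ℂ] B →ₗ[ℂ] C :=
  TensorProduct.lift <| LinearMap.flip <|
    (LinearMap.smulRightₗ (R := ℂ) (M₂ := B) (M := C)) ∘ₗ
      ((LinearMap.mul ℂ B).compr₂ (matrixTrace B)).flip ∘ₗ
        (MulOpposite.opLinearEquiv ℂ).symm.toLinearMap

@[simp]
theorem slice_tmul (c : C) (b : Bᵐᵒᵖ) (y : B) :
    slice B C (c ⊗ₜ b) y = matrixTrace B (y * b.unop) • c := by
  simp [slice]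

/-- Every element of `C ⊗ Bᵒᵖ` is recovered from its slices. -/
theorem sum_slice_tmul {n : ℕ} {e : Fin n → B}
    (he : ∀ b, ∑ i, matrixTrace B (star (e i) * b) • e i = b)
    (x : C ⊗[ℂ] Bᵐᵒᵖ) :
    ∑ k, slice B C x (star (e k)) ⊗ₜ[ℂ] MulOpposite.op (e k) = x := by
  induction x with
  | zero => simp
  | add x₁ x₂ h₁ h₂ =>
    simp only [map_add, LinearMap.add_apply, TensorProduct.add_tmul, Finset.sum_add_distrib, h₁, h₂]
  | tmul c b =>
    simp only [slice_tmul, TensorProduct.smul_tmul, ← MulOpposite.op_smul]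
    rw [← TensorProduct.tmul_sum, ← Finset.op_sum, he, MulOpposite.op_unop]

variable [PartialOrder B] [StarOrderedRing B]

theorem slice_star (x : C ⊗[ℂ] Bᵐᵒᵖ) (y : B) :
    slice B C (star x) (star y) = star (slice B C x y) := by
  induction x with
  | zero => simp
  | add x₁ x₂ h₁ h₂ => simp only [star_add, map_add, LinearMap.add_apply, h₁, h₂]
  | tmul c b =>
    rw [TensorProduct.star_tmul, slice_tmul, slice_tmul, star_smul, ← matrixTrace_star, star_mul,
      matrixTrace_mul_comm, MulOpposite.unop_star]

/-- Parseval's identity with coefficients in `C`. It expresses at once that the matrices of slices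
multiply like the elements of `C ⊗ Bᵒᵖ` and that the slices of `x⋆ x` are completely positive. -/
theorem slice_star_mul {n : ℕ} {e : Fin n → B}
    (he : ∀ b, ∑ i, matrixTrace B (star (e i) * b) • e i = b)
    (x x' : C ⊗[ℂ] Bᵐᵒᵖ) (u v : B) :
    slice B C (star x * x') (star u * v) =
      ∑ l, star (slice B C x (star (e l) * u)) * slice B C x' (star (e l) * v) := by
  induction x with
  | zero => simp
  | add x₁ x₂ h₁ h₂ =>
    simp only [star_add, map_add, LinearMap.add_apply, add_mul, Finset.sum_add_distrib, h₁, h₂]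
  | tmul c b =>
    induction x' with
    | zero => simp
    | add x₁ x₂ h₁ h₂ =>
      simp only [map_add, LinearMap.add_apply, mul_add, Finset.sum_add_distrib, h₁, h₂]
    | tmul c' b' =>
      have h : matrixTrace B (star u * v * (b'.unop * star b.unop)) =
          matrixTrace B (star (u * b.unop) * (v * b'.unop)) := by
        rw [← mul_assoc, matrixTrace_mul_comm, star_mul]
        simp only [mul_assoc]
      simp only [TensorProduct.star_tmul, Algebra.TensorProduct.tmul_mul_tmul, slice_tmul,
        MulOpposite.unop_mul, MulOpposite.unop_star, star_smul, smul_mul_smul_comm]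
      rw [h, matrixTrace_star_mul_eq_sum he, Finset.sum_smul]
      simp only [mul_assoc]

end Slice

/-! ### Positivity in C⋆-algebras and closed ⋆-subalgebras -/

section CStarAlgebra

theorem CStarMatrix.ofMatrix_apply_apply {m n A : Type*} (M : m → n → A) (i : m) (j : n) :
    CStarMatrix.ofMatrix M i j = M i j := rfl

/-- A positive element has the form `b⋆ b`. Stated from a bundled C⋆-algebra structure, so that it
applies to matrices, whose ring structure does not unify with the one expected by the functional
calculus when that is searched for directly. -/
theorem CStarAlgebra.exists_eq_star_mul_self {A : Type*} [NonUnitalCStarAlgebra A] [PartialOrder A]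
    [StarOrderedRing A] {a : A} (ha : 0 ≤ a) : ∃ b, a = star b * b :=
  CStarAlgebra.nonneg_iff_eq_star_mul_self.mp ha

/-- The range of a ⋆-homomorphism `π` with a left inverse `ρ` is closed if `π ∘ ρ` is
continuous, being the fixed point set of `π ∘ ρ`. It then contains the square root of each of its
positive elements, so positivity under `π` lifts to the domain, on which no norm is needed. -/
theorem NonUnitalStarAlgHom.exists_eq_star_mul_self_of_nonneg_map {D A : Type*}
    [NonUnitalSemiring D] [StarRing D] [Module ℂ D] [NonUnitalCStarAlgebra A] [PartialOrder A]
    [StarOrderedRing A] (π : D →⋆ₙₐ[ℂ] A) (ρ : A → D) (hρ : ∀ x, ρ (π x) = x)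
    (hcont : Continuous fun a => π (ρ a)) {x : D} (hx : 0 ≤ π x) : ∃ y, x = star y * y := by
  have hcl : IsClosed (NonUnitalStarAlgHom.range π : Set A) := by
    have hfix : (NonUnitalStarAlgHom.range π : Set A) = {a | π (ρ a) = a} := by
      ext a
      constructor
      · rintro ⟨y, rfl⟩
        exact congrArg π (hρ y)
      · exact fun h => ⟨ρ a, h⟩
    rw [hfix]
    exact isClosed_eq hcont continuous_id
  have hmem : CFC.sqrt (π x) ∈ NonUnitalStarAlgHom.range π := by
    rw [CFC.sqrt_eq_real_sqrt _ hx]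
    exact cfcₙ_mem (𝕜' := ℂ) Real.sqrt ⟨x, rfl⟩
  obtain ⟨y, hy⟩ := hmem
  change π y = _ at hy
  refine ⟨y, Function.LeftInverse.injective hρ ?_⟩
  rw [map_mul, map_star, hy, (CFC.sqrt_nonneg _).star_eq]
  exact CStarAlgebra.nonneg_iff_eq_sqrt_mul_sqrt.mp hx

end CStarAlgebra

/-! ### The right regular representation -/

section Representation

variable {B : Type*} [CStarAlgebra B] [FiniteDimensional ℂ B] [PartialOrder B] [StarOrderedRing B]
  (C : Type*) [NonUnitalCStarAlgebra C]
  {n : ℕ} {e : Fin n → B} (he : ∀ b, ∑ i, matrixTrace B (star (e i) * b) • e i = b)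

/-- The representation of `C ⊗ Bᵒᵖ` by matrices over `C` whose `(p, q)` entry is
`Tr (e p⋆ e q b) • c` at `c ⊗ b`. If `e` is an orthonormal basis, this is the matrix of right multiplication by `b` on
`B`, with coefficient `c`; the construction only uses the reconstruction formula of `e`. -/
noncomputable def rightRegularRep : C ⊗[ℂ] Bᵐᵒᵖ →⋆ₙₐ[ℂ] CStarMatrix (Fin n) (Fin n) C where
  toFun x := CStarMatrix.ofMatrix fun p q => slice B C x (star (e p) * e q)
  map_smul' r x := by ext; simp [CStarMatrix.ofMatrix_apply_apply]
  map_zero' := by ext; simp [CStarMatrix.ofMatrix_apply_apply]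
  map_add' x y := by ext; simp [CStarMatrix.ofMatrix_apply_apply]
  map_mul' x y := by
    ext p q
    have h (l : Fin n) : star (slice B C (star x) (star (e l) * e p)) =
        slice B C x (star (e p) * e l) := by
      rw [← slice_star, star_star, star_mul, star_star]
    have h2 := slice_star_mul he (star x) y (e p) (e q)
    simp only [star_star, h] at h2
    simpa [CStarMatrix.mul_apply, CStarMatrix.ofMatrix_apply_apply] using h2
  map_star' x := by
    ext p q
    simp [CStarMatrix.star_apply, CStarMatrix.ofMatrix_apply_apply, ← slice_star]

@[simp]
theorem rightRegularRep_apply (x : C ⊗[ℂ] Bᵐᵒᵖ) (p q : Fin n) :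
    rightRegularRep C he x p q = slice B C x (star (e p) * e q) := rfl

/-- A left inverse of `rightRegularRep`. It expands `1` in the family `e` to recover the slices
`Tr (e k⋆ ·)` of an element from the matrix entries. -/
theorem sum_rightRegularRep_tmul (x : C ⊗[ℂ] Bᵐᵒᵖ) :
    ∑ k, (∑ q, matrixTrace B (star (e q)) • rightRegularRep C he x k q) ⊗ₜ[ℂ]
      MulOpposite.op (e k) = x := by
  refine Eq.trans (Finset.sum_congr rfl fun k _ => ?_) (sum_slice_tmul he x)
  congr 1
  have h1 := he 1
  simp only [mul_one] at h1
  simp only [rightRegularRep_apply, ← map_smul, ← map_sum, ← mul_smul_comm, ← Finset.mul_sum, h1,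
    mul_one]

/-- Positivity in `C ⊗ Bᵒᵖ` can be tested in the right regular representation. -/
theorem mem_positiveElements_of_rightRegularRep_nonneg [PartialOrder C] [StarOrderedRing C]
    (x : C ⊗[ℂ] Bᵐᵒᵖ) (hx : 0 ≤ rightRegularRep C he x) : x ∈ positiveElements B C := by
  refine NonUnitalStarAlgHom.exists_eq_star_mul_self_of_nonneg_map (rightRegularRep C he)
    (fun M => ∑ k, (∑ q, matrixTrace B (star (e q)) • M k q) ⊗ₜ[ℂ] MulOpposite.op (e k))
    (sum_rightRegularRep_tmul C he) ?_ hx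
  refine continuous_pi fun p => continuous_pi fun q => ?_
  have hentry (k l : Fin n) : Continuous fun M : CStarMatrix (Fin n) (Fin n) C => M k l :=
    (continuous_apply l).comp (continuous_apply k)
  simp only [rightRegularRep_apply, map_sum, LinearMap.sum_apply, slice_tmul]
  exact continuous_finsetSum _ fun k _ => (continuous_finsetSum _ fun l _ =>
    (hentry k l).const_smul _).const_smul _

end Representation

/-! ### The inversion formula and positivity -/

section Correspondence

variable {B C : Type*} [CStarAlgebra B] [FiniteDimensional ℂ B] [NonUnitalCStarAlgebra C]
  (ψ : FaithfulState B)

theorem FaithfulState.dualEquiv_apply (a b : B) : ψ.dualEquiv a b = ψ.toLinearMap (a * b) := rfl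

/-- A linear map on `𝓑(B, C)` is determined by its values on the maps `θ_{ψ a, c}`, as these
span. -/
theorem FaithfulState.linearMap_ext_rankOneMap {V : Type*} [AddCommGroup V] [Module ℂ V]
    {Φ Φ' : (B →ₗ[ℂ] C) →ₗ[ℂ] V}
    (h : ∀ (a : B) (c : C), Φ (rankOneMap (ψ.dualEquiv a) c) =
      Φ' (rankOneMap (ψ.dualEquiv a) c)) : Φ = Φ' := by
  suffices H : Φ ∘ₗ (dualTensorHomEquiv ℂ B C).toLinearMap =
      Φ' ∘ₗ (dualTensorHomEquiv ℂ B C).toLinearMap by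
    ext θ
    obtain ⟨t, rfl⟩ := (dualTensorHomEquiv ℂ B C).surjective θ
    exact LinearMap.congr_fun H t
  refine TensorProduct.ext' fun f c => ?_
  obtain ⟨a, rfl⟩ := ψ.dualEquiv.surjective f
  have h1 : dualTensorHomEquiv ℂ B C (ψ.dualEquiv a ⊗ₜ c) = rankOneMap (ψ.dualEquiv a) c := by
    ext b
    simp [rankOneMap]
  simp only [LinearMap.comp_apply, LinearEquiv.coe_coe, h1, h]

variable [PartialOrder B] [StarOrderedRing B]

theorem FaithfulState.choiMap_rankOneMap (a : B) (c : C) :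
    ψ.choiMap C (rankOneMap (ψ.dualEquiv a) c) =
      c ⊗ₜ[ℂ] MulOpposite.op (ψ.modular (-(Complex.I / 2)) a) := by
  have h : (dualTensorHomEquiv ℂ B C).symm (rankOneMap (ψ.dualEquiv a) c) =
      ψ.dualEquiv a ⊗ₜ c := by
    rw [LinearEquiv.symm_apply_eq]
    ext b
    simp [rankOneMap]
  simp only [choiMap, LinearMap.comp_apply, LinearEquiv.coe_coe, h, TensorProduct.comm_tmul,
    TensorProduct.map_tmul, LinearMap.id_apply, LinearEquiv.symm_apply_apply,
    MulOpposite.coe_opLinearEquiv]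

/-- The inversion formula for `Ψ'`: the map `θ` is recovered from `Ψ' θ` as
`y ↦ (id ⊗ Tr (Q ^ (1/2) y Q ^ (1/2) ·)) (Ψ' θ)`. -/
theorem FaithfulState.slice_choiMap (θ : B →ₗ[ℂ] C) (y : B) :
    slice B C (ψ.choiMap C θ) (ψ.sqrtDensity * y * ψ.sqrtDensity) = θ y := by
  suffices H : (slice B C ∘ₗ ψ.choiMap C).compl₂
      (LinearMap.mulLeftRight ℂ (ψ.sqrtDensity, ψ.sqrtDensity)) = LinearMap.id by
    simpa using LinearMap.congr_fun₂ H θ y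
  refine ψ.linearMap_ext_rankOneMap fun a c => ?_
  ext y
  simp only [LinearMap.compl₂_apply, LinearMap.comp_apply,
    LinearMap.id_apply, choiMap_rankOneMap, modular_neg_I_div_two, slice_tmul,
    LinearMap.mulLeftRight_apply, MulOpposite.unop_op]
  rw [rankOneMap, LinearMap.smulRight_apply, dualEquiv_apply, apply_eq_trace,
    ← ψ.sqrtDensity_mul_self]
  congr 1
  have h1 : ψ.sqrtDensity * y * ψ.sqrtDensity * (ψ.sqrtDensity * a * ψ.invSqrtDensity) =
      ψ.sqrtDensity * (y * (ψ.sqrtDensity * (ψ.sqrtDensity * a)) * ψ.invSqrtDensity) := by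
    simp only [mul_assoc]
  rw [h1, matrixTrace_mul_comm, mul_assoc _ ψ.invSqrtDensity, invSqrtDensity_mul_sqrtDensity,
    mul_one, matrixTrace_mul_comm]
  simp only [mul_assoc]

theorem FaithfulState.slice_choiMap' (θ : B →ₗ[ℂ] C) (y : B) :
    slice B C (ψ.choiMap C θ) y = θ (ψ.invSqrtDensity * y * ψ.invSqrtDensity) := by
  rw [← ψ.slice_choiMap θ]
  congr 1
  simp only [mul_assoc, invSqrtDensity_mul_sqrtDensity, mul_one]
  rw [← mul_assoc, sqrtDensity_mul_invSqrtDensity, one_mul]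

theorem FaithfulState.choiMap_injective : Function.Injective (ψ.choiMap C) := fun θ θ' h => by
  ext y
  rw [← ψ.slice_choiMap, h, ψ.slice_choiMap]

theorem FaithfulState.choiMap_surjective : Function.Surjective (ψ.choiMap C) := fun x => by
  obtain ⟨n, e, he⟩ := exists_trace_frame ψ
  refine ⟨slice B C x ∘ₗ LinearMap.mulLeftRight ℂ (ψ.sqrtDensity, ψ.sqrtDensity), ?_⟩
  rw [← sum_slice_tmul he (ψ.choiMap C _)]
  simp only [slice_choiMap', LinearMap.comp_apply,
    LinearMap.mulLeftRight_apply]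
  simp only [mul_assoc, invSqrtDensity_mul_sqrtDensity, mul_one]
  simp only [← mul_assoc, sqrtDensity_mul_invSqrtDensity, one_mul]
  exact sum_slice_tmul he x

variable [PartialOrder C] [StarOrderedRing C]

/-- The right regular representation sends `Ψ' θ` to the amplification of `θ` applied to the
positive matrix with entries `(e p Q ^ (-1/2))⋆ (e q Q ^ (-1/2))`. -/
theorem FaithfulState.choiMap_mem_positiveElements {θ : B →ₗ[ℂ] C}
    (hθ : θ ∈ completelyPositiveMaps B C) : ψ.choiMap C θ ∈ positiveElements B C := by
  obtain ⟨φ, rfl⟩ := hθ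
  obtain ⟨n, e, he⟩ := exists_trace_frame ψ
  apply mem_positiveElements_of_rightRegularRep_nonneg C he
  rcases Nat.eq_zero_or_pos n with rfl | hn
  · exact (CStarMatrix.ext fun p => p.elim0 : rightRegularRep C he _ = 0).ge
  -- The row `(e q h⁻¹)_q`, with `h⁻¹ = Q ^ (-1/2)`, filled up with zero rows to a square matrix.
  let N : CStarMatrix (Fin n) (Fin n) B :=
    CStarMatrix.ofMatrix fun r q => if r = ⟨0, hn⟩ then e q * ψ.invSqrtDensity else 0
  convert φ.map_cstarMatrix_nonneg' n (star N * N) (star_mul_self_nonneg N) using 1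
  ext p q
  have hN : (star N * N) p q =
      star (e p * ψ.invSqrtDensity) * (e q * ψ.invSqrtDensity) := by
    rw [CStarMatrix.mul_apply, Finset.sum_eq_single ⟨0, hn⟩]
    · simp [N, CStarMatrix.star_apply, CStarMatrix.ofMatrix_apply_apply]
    · intro r _ hr
      simp [N, hr, CStarMatrix.ofMatrix_apply_apply]
    · simp
  rw [CStarMatrix.map_apply, hN, rightRegularRep_apply, slice_choiMap', star_mul,
    star_invSqrtDensity]
  simp only [mul_assoc]

/-- If `Ψ' θ = x⋆ x` then `θ` maps `N⋆ N` to `∑ l, (N' l)⋆ (N' l)`, where `N' l` is obtained by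
slicing `x` along the entries of `N`. -/
theorem FaithfulState.mem_completelyPositiveMaps_of_choiMap_mem {θ : B →ₗ[ℂ] C}
    (hθ : ψ.choiMap C θ ∈ positiveElements B C) : θ ∈ completelyPositiveMaps B C := by
  obtain ⟨n, e, he⟩ := exists_trace_frame ψ
  obtain ⟨x, hx⟩ := hθ
  refine ⟨⟨θ, fun k M hM => ?_⟩, rfl⟩
  obtain ⟨N, rfl⟩ := CStarAlgebra.exists_eq_star_mul_self hM
  let N' (l : Fin n) : CStarMatrix (Fin k) (Fin k) C :=
    CStarMatrix.ofMatrix fun r q => slice B C x (star (e l) * (N r q * ψ.sqrtDensity))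
  have h : (star N * N).map θ = ∑ l, star (N' l) * N' l := by
    ext p q
    have hentry (f : Fin n → CStarMatrix (Fin k) (Fin k) C) :
        (∑ l, f l) p q = ∑ l, f l p q := Matrix.sum_apply p q Finset.univ f
    simp only [hentry, CStarMatrix.map_apply, CStarMatrix.mul_apply, map_sum]
    rw [Finset.sum_comm]
    refine Finset.sum_congr rfl fun r _ => ?_
    have h1 := slice_star_mul he x x (N r p * ψ.sqrtDensity) (N r q * ψ.sqrtDensity)
    rw [← hx, star_mul, star_sqrtDensity] at h1
    rw [CStarMatrix.star_apply, ← ψ.slice_choiMap]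
    simpa only [N', CStarMatrix.star_apply, CStarMatrix.ofMatrix_apply_apply, mul_assoc] using h1
  change 0 ≤ (star N * N).map θ
  rw [h]
  exact Finset.sum_nonneg fun l _ => star_mul_self_nonneg (N' l)

end Correspondence

/-! ### The correspondence -/

theorem mainTheorem8 {B C : Type*} [CStarAlgebra B] [FiniteDimensional ℂ B] [PartialOrder B]
    [StarOrderedRing B] [NonUnitalCStarAlgebra C] [PartialOrder C] [StarOrderedRing C]
    (ψ : FaithfulState B) :
    (∀ Φ : (B →ₗ[ℂ] C) →ₗ[ℂ] C ⊗[ℂ] Bᵐᵒᵖ,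
      (∀ (a : B) (c : C), Φ (rankOneMap (ψ.dualEquiv a) c) =
        c ⊗ₜ[ℂ] MulOpposite.op (ψ.modular (-(Complex.I / 2)) a)) ↔ Φ = ψ.choiMap C) ∧
    Set.BijOn (ψ.choiMap C) (completelyPositiveMaps B C) (positiveElements B C) := by
  refine ⟨fun Φ => ⟨fun h => ψ.linearMap_ext_rankOneMap fun a c => ?_, ?_⟩,
    fun θ => ψ.choiMap_mem_positiveElements, ψ.choiMap_injective.injOn, fun x hx => ?_⟩
  · rw [h, ψ.choiMap_rankOneMap]
  · rintro rfl
    exact ψ.choiMap_rankOneMap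
  · obtain ⟨θ, rfl⟩ := ψ.choiMap_surjective x
    exact ⟨θ, ψ.mem_completelyPositiveMaps_of_choiMap_mem hx, rfl⟩
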